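/- **Setting.** Let $G$ be a finite nonempty simple graph on agents $V=\{1,\dots,n\}$ without isolated vertices, $N_i$ the set of neighbours of $i$, $d_i=|N_i|$, and let $c>0$, $e^*>0$ and $B\in\mathbb{R}$ be fixed. Let $\mathcal{B}$ be the set of differentiable functions $b:\mathbb{R}\to\mathbb{R}$ with $b'(y)>0$ and $b''(y)<0$ for all $y\ge 0$, $b(e^*)=B$ and $b'(e^*)=c$. In the public goods game with benefit function $b$, agent $i$ chooses an effort $x_i\ge 0$ and has utility $U_i(x)=b\big(x_i+\sum_{j\in N_i}x_j\big)-cx_i$; the welfare of $x$ is $W_b(x)=\sum_i U_i(x)$. A Nash equilibrium is a profile $x\geq 0$ from which no agent gains by a unilateral deviation to another nonnegative effort; it is *specialized* if $x_i\in\{0,e^*\}$ for all $i$, and *distributed* if $x_i>0$ for all $i$. Let $W_b^*$ and $W_b^{S*}$ be the maximum of $W_b$ over all equilibria and over all specialized equilibria, and $W_b^{D*}$ the infimum of $W_b$ over all distributed equilibria ($+\infty$ if there are none). The concavity of $b$ is $$\sigma_b=\frac{b(ne^*)-b(e^*)}{ce^*(n-1)}.$$ A limit as $\sigma_b\to s$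 is taken over $b\in\mathcal{B}$, that is, with $b(e^*)=B$ and $b'(e^*)=c$ fixed: $\lim_{\sigma_b\to s}F(b)=L$ means that for every $\epsilon>0$ there is $\delta>0$ such that $|F(b)-L|<\epsilon$ for all $b\in\mathcal{B}$ with $|\sigma_b-s|<\delta$. **Theorem.** The maxima $W_b^*$ and $W_b^{S*}$ are attained for every $b\in\mathcal{B}$, and $\mathcal{B}$ contains functions with $\sigma_b$ arbitrarily close to $1$ and functions with $\sigma_b$ arbitrarily close to $0$. Moreover: (a) Let $S^*$ be an independent set of maximum weight for the weights $d=(d_1,\dots,d_n)$, let $\alpha_d(G)$ be its weight, and let $x^*$ be the profile with $x^*_i=e^*$ for $i\in S^*$ and $x^*_i=0$ otherwise. Then $x^*$ is a specialized equilibrium for every $b\in\mathcal{B}$ and $$\lim_{\sigma_b\to1}W_b^*=\lim_{\sigma_b\to1}W_b(x^*)=\lim_{\sigma_b\to1}W_b^{S*}=n\big(b(e^*)-ce^*\big)+ce^*\alpha_d(G).$$ (b) Suppose $G$ is a forest. Let $S'$ be a maximal independent set of the smallest cardinality, $\beta(G)=|S'|$, and let $x'$ be the profile with $x'_i=e^*$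 for $i\in S'$ and $x'_i=0$ otherwise. Then $x'$ is a specialized equilibrium for every $b\in\mathcal{B}$ and $$\lim_{\sigma_b\to0}W_b^*=\lim_{\sigma_b\to0}W_b(x')=\lim_{\sigma_b\to0}W_b^{S*}=nb(e^*)-ce^*\beta(G).$$ (c) A profile that is a distributed equilibrium for one $b\in\mathcal{B}$ is a distributed equilibrium, with the same welfare, for every $b\in\mathcal{B}$. Moreover $\lim_{\sigma_b\to0}W_b^{S*}$ exists, and $$W_b^{D*}\ \ge\ \lim_{\sigma_b\to0}W_b^{S*}\qquad\text{for every } b\in\mathcal{B}.$$ -/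

import Mathlib

open Filter Topology

namespace PublicGoods

noncomputable section

/-- A benefit function: differentiable, with positive first and negative second derivative at every
effort level `y ≥ 0`.  (A nonzero value of `deriv (deriv b) y` forces `b'` to be differentiable
at `y`, so no default value of `deriv` can occur here.) -/
structure IsBenefit (b : ℝ → ℝ) : Prop where
  differentiable : Differentiable ℝ b
  deriv_pos : ∀ y, 0 ≤ y → 0 < deriv b y
  deriv_deriv_neg : ∀ y, 0 ≤ y → deriv (deriv b) y < 0

/-- The benefit functions with the value `b(e) = B` and the slope `b'(e) = c` held fixed. -/
def benefitFamily (c e B : ℝ) : Set (ℝ → ℝ) :=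
  {b | IsBenefit b ∧ b e = B ∧ deriv b e = c}

/-- The concavity `σ_b = (b(n e) - b(e)) / (c e (n - 1))` of a benefit function. -/
def concavity (n : ℕ) (c e : ℝ) (b : ℝ → ℝ) : ℝ :=
  (b (n * e) - b e) / (c * e * ((n : ℝ) - 1))

/-- The filter "`σ_b → s` while `b(e) = B` and `b'(e) = c` are kept fixed": a set of benefit
functions is in it iff it contains, for some neighbourhood of `s`, all the members of
`benefitFamily c e B` whose concavity lies in that neighbourhood. -/
def concavityTo (n : ℕ) (c e B s : ℝ) : Filter (ℝ → ℝ) :=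
  comap (concavity n c e) (𝓝 s) ⊓ 𝓟 (benefitFamily c e B)

section Game

variable {V : Type*} [Fintype V] [DecidableEq V]
variable (G : SimpleGraph V) [DecidableRel G.Adj]

/-- The effort of the closed neighbourhood of agent `i`. -/
def closedEffort (x : V → ℝ) (i : V) : ℝ :=
  x i + ∑ j ∈ G.neighborFinset i, x j

/-- The utility of agent `i`. -/
def utility (c : ℝ) (b : ℝ → ℝ) (x : V → ℝ) (i : V) : ℝ :=
  b (closedEffort G x i) - c * x i

/-- The utilitarian welfare. -/
def welfare (c : ℝ) (b : ℝ → ℝ) (x : V → ℝ) : ℝ :=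
  ∑ i, utility G c b x i

/-- The Nash equilibria: nonnegative effort profiles from which no agent has an incentive to
deviate unilaterally to another nonnegative effort. -/
def NE (c : ℝ) (b : ℝ → ℝ) : Set (V → ℝ) :=
  {x | (∀ i, 0 ≤ x i) ∧
    ∀ i, ∀ y, 0 ≤ y → utility G c b (Function.update x i y) i ≤ utility G c b x i}

/-- The specialized equilibria: every effort is `0` or `e`. -/
def SNE (c e : ℝ) (b : ℝ → ℝ) : Set (V → ℝ) :=
  {x | x ∈ NE G c b ∧ ∀ i, x i = 0 ∨ x i = e}

/-- The distributed equilibria: every effort is positive. -/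
def DNE (c : ℝ) (b : ℝ → ℝ) : Set (V → ℝ) :=
  {x | x ∈ NE G c b ∧ ∀ i, 0 < x i}

/-- The maximum equilibrium welfare. -/
def maxWelfare (c : ℝ) (b : ℝ → ℝ) : ℝ :=
  sSup (welfare G c b '' NE G c b)

/-- The maximum welfare of a specialized equilibrium. -/
def maxSpecializedWelfare (c e : ℝ) (b : ℝ → ℝ) : ℝ :=
  sSup (welfare G c b '' SNE G c e b)

/-- The infimum of the welfare over the distributed equilibria, in the extended reals (so it is
`+∞` if there is no distributed equilibrium). -/
def infDistributedWelfare (c : ℝ) (b : ℝ → ℝ) : EReal :=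
  ⨅ x ∈ DNE G c b, ((welfare G c b x : ℝ) : EReal)

end Game

section Independent

variable {V : Type*}

/-- The profile in which the agents in `S` exert effort `e` and all others free ride. -/
def specialistProfile [DecidableEq V] (e : ℝ) (S : Finset V) (i : V) : ℝ :=
  if i ∈ S then e else 0

/-- The `w`-weighted independence number. -/
def weightedIndepNum (G : SimpleGraph V) (w : V → ℝ) : ℝ :=
  sSup {r | ∃ S : Finset V, G.IsIndepSet (S : Set V) ∧ r = ∑ i ∈ S, w i}

/-- `S` is a maximum `w`-weighted independent set. -/
def IsMaxWeightIndepSet (G : SimpleGraph V) (w : V → ℝ) (S : Finset V) : Prop :=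
  G.IsIndepSet (S : Set V) ∧
    ∀ T : Finset V, G.IsIndepSet (T : Set V) → ∑ i ∈ T, w i ≤ ∑ i ∈ S, w i

/-- `S` is an independent set that is maximal for inclusion. -/
def IsMaximalIndepSet (G : SimpleGraph V) (S : Finset V) : Prop :=
  Maximal (fun T : Finset V => G.IsIndepSet (T : Set V)) S

/-- `S` is a maximal independent set of the smallest cardinality. -/
def IsSmallestMaximalIndepSet (G : SimpleGraph V) (S : Finset V) : Prop :=
  IsMaximalIndepSet G S ∧ ∀ T : Finset V, IsMaximalIndepSet G T → S.card ≤ T.card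

/-- The independent domination number: the least cardinality of a maximal independent set. -/
def indepDomNum (G : SimpleGraph V) : ℕ :=
  sInf {k | ∃ S : Finset V, IsMaximalIndepSet G S ∧ S.card = k}

end Independent

end

end PublicGoods

/-! Since `b z - c * z` increases up to `e` and decreases beyond it, a profile is an equilibrium iff
every closed neighbourhood carries effort at least `e`, with equality at every active agent
(`mem_NE_iff`). This condition does not involve `b`. All closed efforts then lie in `[e, n e]`, and
the specialized equilibria are exactly the profiles of maximal independent sets.

On `[e, n e]` a benefit function lies between its chord of slope `σ c` and its tangent of slope `c`,
and also between `B` and `B + σ c e (n - 1)`. So, uniformly over equilibria, welfare tends to `n (B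
- c e) + c ∑ dᵢ xᵢ` as `σ → 1` and to `n B - c ∑ xᵢ` as `σ → 0`. Two linear optimization problems
over the equilibria remain, and each is solved by rounding.

For `σ → 1`, a greedy choice turns an equilibrium into an independent set of no smaller degree
weight (`exists_indep_sum_mul_le_sum`). For `σ → 0` in a forest, the support of an equilibrium
induces only isolated vertices and single edges. Hall's theorem picks endpoints of these edges so
that the resulting independent set dominates the graph, and each chosen vertex pays with its own
disjoint share `e` of the total effort (`IsComplementary.exists_isMaximalIndepSet_card_le`).

In a distributed equilibrium every closed effort equals `e`, so covering the graph by the closed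
neighbourhoods of a maximal independent set `S` bounds total effort by `e |S|`. This gives (c) in
any graph. -/

namespace PublicGoods

/-! ### Counting and matching in forests -/

section Forest

variable {V : Type*} [Fintype V] [DecidableEq V] {G : SimpleGraph V} [DecidableRel G.Adj]

/-- In a forest, every nonempty set of vertices contains one with at most one neighbour in it. -/
theorem exists_card_neighborFinset_inter_le_one (hG : G.IsAcyclic) {T : Finset V}
    (hT : T.Nonempty) : ∃ i ∈ T, (G.neighborFinset i ∩ T).card ≤ 1 := by
  classical
  have : Nonempty (T : Set V) := hT.to_subtype
  have hH := hG.induce (T : Set V)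
  obtain ⟨u, v, p, hp, hmax⟩ :=
    SimpleGraph.Walk.exists_isPath_forall_isPath_length_le_length (G.induce (T : Set V))
  -- The end of a longest path is a leaf: any other neighbour would either close a cycle or extend
  -- the path.
  have key : ∀ w : (T : Set V), G.Adj v w → w = p.penultimate := by
    intro w hw
    have hadj : (G.induce (T : Set V)).Adj v w := hw
    apply hH.eq_penultimate_of_adj_end hp hadj
    by_contra hns
    have h1 := hmax _ _ _ (hp.concat hns hadj)
    rw [SimpleGraph.Walk.length_concat] at h1
    omega
  refine ⟨v, v.2, Finset.card_le_one.2 fun a ha b hb => ?_⟩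
  simp only [Finset.mem_inter, SimpleGraph.mem_neighborFinset] at ha hb
  have h1 := key ⟨a, ha.2⟩ ha.1
  have h2 := key ⟨b, hb.2⟩ hb.1
  exact congrArg Subtype.val (h1.trans h2.symm)

/-- The degree sum of a subforest is at most twice its number of vertices. -/
theorem sum_card_neighborFinset_inter_le (hG : G.IsAcyclic) (T : Finset V) :
    ∑ i ∈ T, (G.neighborFinset i ∩ T).card ≤ 2 * T.card := by
  induction hn : T.card generalizing T with
  | zero => simp [Finset.card_eq_zero.1 hn]
  | succ n ih =>
    -- Deleting a vertex of degree at most one lowers the degree sum by at most two: its own degree,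
    -- and as much again at its neighbours.
    obtain ⟨v, hv, hv1⟩ := exists_card_neighborFinset_inter_le_one hG
      (Finset.card_pos.1 (by omega : 0 < T.card))
    have hcard : (T.erase v).card = n := by rw [Finset.card_erase_of_mem hv]; omega
    have h1 := ih _ hcard
    have h2 : ∀ i, (G.neighborFinset i ∩ T).card
        = (G.neighborFinset i ∩ T.erase v).card + if i ∈ G.neighborFinset v then 1 else 0 := by
      intro i
      by_cases h : i ∈ G.neighborFinset v
      · have hvi : v ∈ G.neighborFinset i ∩ T := by
          simpa [hv] using ((SimpleGraph.mem_neighborFinset ..).1 h).symm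
        rw [if_pos h, Finset.inter_erase, Finset.card_erase_add_one hvi]
      · have hvi : v ∉ G.neighborFinset i ∩ T := by
          simp only [SimpleGraph.mem_neighborFinset, Finset.mem_inter] at h ⊢
          exact fun h' => h h'.1.symm
        rw [if_neg h, Finset.inter_erase, Finset.erase_eq_of_notMem hvi, add_zero]
    have h3 : ∑ i ∈ T.erase v, (if i ∈ G.neighborFinset v then 1 else 0)
        ≤ (G.neighborFinset v ∩ T).card := by
      rw [← Finset.card_filter]
      apply Finset.card_le_card
      intro i
      simp only [Finset.mem_filter, Finset.mem_erase, Finset.mem_inter]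
      tauto
    rw [← Finset.add_sum_erase T _ hv, Finset.sum_congr rfl (fun i _ => h2 i),
      Finset.sum_add_distrib]
    omega

/-- If positive weights on the vertices of a subforest have sum `e` over all closed neighbourhoods,
then the subforest has maximum degree at most one. -/
theorem card_neighborFinset_inter_le_one_of_closed_sum (hG : G.IsAcyclic) {P : Finset V}
    {x : V → ℝ} {e : ℝ} (hpos : ∀ i ∈ P, 0 < x i)
    (hsum : ∀ i ∈ P, x i + ∑ j ∈ G.neighborFinset i ∩ P, x j = e) {i : V} (hi : i ∈ P) :
    (G.neighborFinset i ∩ P).card ≤ 1 := by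
  by_contra! hlt
  -- Take a leaf `k` of the subforest of vertices of degree at least two. Some neighbour `j` of `k`
  -- is a leaf of `P`, so `x j + x k = e`. A second neighbour `l` of `k` then gets `x l ≤ 0` from
  -- the equation at `k`.
  obtain ⟨k, hk, hk1⟩ := exists_card_neighborFinset_inter_le_one hG
    (T := {k ∈ P | 1 < (G.neighborFinset k ∩ P).card}) ⟨i, by simp [hi, hlt]⟩
  obtain ⟨hkP, hkd⟩ := Finset.mem_filter.1 hk
  obtain ⟨j, hj, hj1⟩ : ∃ j ∈ G.neighborFinset k ∩ P, (G.neighborFinset j ∩ P).card ≤ 1 := by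
    by_contra! h
    have : (G.neighborFinset k ∩ P).card
        ≤ (G.neighborFinset k ∩ {k ∈ P | 1 < (G.neighborFinset k ∩ P).card}).card := by
      apply Finset.card_le_card
      intro j hj
      have := h j hj
      simp only [Finset.mem_inter, Finset.mem_filter] at hj ⊢
      exact ⟨hj.1, hj.2, this⟩
    omega
  have hjP := (Finset.mem_inter.1 hj).2
  have hkj : k ∈ G.neighborFinset j ∩ P := by
    simp only [Finset.mem_inter, SimpleGraph.mem_neighborFinset] at hj ⊢
    exact ⟨hj.1.symm, hkP⟩
  have hjset : G.neighborFinset j ∩ P = {k} :=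
    Finset.eq_singleton_iff_unique_mem.2 ⟨hkj, fun a ha => Finset.card_le_one.1 hj1 _ ha _ hkj⟩
  have ej := hsum j hjP
  rw [hjset, Finset.sum_singleton] at ej
  obtain ⟨l, hl, hlj⟩ := Finset.exists_mem_ne hkd j
  have ek := hsum k hkP
  have : x j + x l ≤ ∑ a ∈ G.neighborFinset k ∩ P, x a := by
    rw [← Finset.sum_pair hlj.symm]
    apply Finset.sum_le_sum_of_subset_of_nonneg
    · intro a; simp only [Finset.mem_insert, Finset.mem_singleton]; rintro (rfl | rfl) <;> assumption
    · intro a ha _; exact (hpos a (Finset.mem_inter.1 ha).2).le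
  have := hpos l (Finset.mem_inter.1 hl).2
  linarith

/-- In a forest, let `P` be a set of vertices of maximum degree at most one and let `D` be a set of
vertices outside of `P` which have at least two neighbours in `P`, all of them matched in `P`. Then
there is an independent subset of `P` that dominates `D`. -/
theorem exists_indep_dominating_of_matching (hG : G.IsAcyclic) {P D : Finset V}
    (hPD : Disjoint P D) (hP : ∀ i ∈ P, (G.neighborFinset i ∩ P).card ≤ 1)
    (hD2 : ∀ v ∈ D, 2 ≤ (G.neighborFinset v ∩ P).card)
    (hDm : ∀ v ∈ D, ∀ q ∈ G.neighborFinset v ∩ P, (G.neighborFinset q ∩ P).Nonempty) :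
    ∃ I ⊆ P, G.IsIndepSet (I : Set V) ∧ ∀ v ∈ D, ∃ q ∈ I, G.Adj v q := by
  classical
  -- For `q ∈ P` this is the component of `q` in the graph induced on `P`. Hall's theorem will
  -- assign distinct components to the vertices of `D`.
  set comp : V → Finset V := fun q => insert q (G.neighborFinset q ∩ P) with hcomp
  have comp_card : ∀ q ∈ P, (comp q).card ≤ 2 := fun q hq =>
    (Finset.card_insert_le _ _).trans (by have := hP q hq; omega)
  have comp_sub : ∀ q ∈ P, comp q ⊆ P := fun q hq =>
    Finset.insert_subset hq Finset.inter_subset_right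
  have comp_eq : ∀ q ∈ P, ∀ r ∈ P, G.Adj q r → comp q = comp r := by
    intro q hq r hr h
    have h1 : ∀ a ∈ P, ∀ b ∈ P, G.Adj a b → G.neighborFinset a ∩ P = {b} := by
      intro a ha b hb hab
      have hm : b ∈ G.neighborFinset a ∩ P := by simp [hab, hb]
      exact Finset.eq_singleton_iff_unique_mem.2
        ⟨hm, fun z hz => Finset.card_le_one.1 (hP a ha) _ hz _ hm⟩
    simp only [hcomp, h1 q hq r hr h, h1 r hr q hq h.symm]
    exact Finset.pair_comm q r
  let t : D → Finset (Finset V) := fun v => (G.neighborFinset v ∩ P).image comp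
  have hall : ∀ A : Finset D, A.card ≤ (A.biUnion t).card := by
    intro A
    set A' : Finset V := A.image Subtype.val with hA'
    have hA'card : A'.card = A.card := Finset.card_image_of_injective _ Subtype.val_injective
    have hA'D : ∀ v ∈ A', v ∈ D := by
      intro v hv
      obtain ⟨a, -, rfl⟩ := Finset.mem_image.1 hv
      exact a.2
    set Q : Finset V := (A.biUnion t).biUnion id with hQ
    have memt : ∀ C, C ∈ A.biUnion t ↔ ∃ v ∈ A', ∃ q ∈ G.neighborFinset v ∩ P, comp q = C := by
      intro C; simp [t, hA']
    have memQ : ∀ r, r ∈ Q ↔ ∃ v ∈ A', ∃ q ∈ G.neighborFinset v ∩ P, r ∈ comp q := by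
      intro r
      simp only [hQ, Finset.mem_biUnion (t := id), memt, id]
      constructor
      · rintro ⟨C, ⟨v, hv, q, hq, rfl⟩, hr⟩; exact ⟨v, hv, q, hq, hr⟩
      · rintro ⟨v, hv, q, hq, hr⟩; exact ⟨_, ⟨v, hv, q, hq, rfl⟩, hr⟩
    have hQP : Q ⊆ P := by
      intro r hr
      obtain ⟨v, -, q, hq, hr⟩ := (memQ r).1 hr
      exact comp_sub q (Finset.mem_inter.1 hq).2 hr
    have hQcard : Q.card ≤ 2 * (A.biUnion t).card := by
      rw [mul_comm]
      refine Finset.card_biUnion_le_card_mul _ _ _ fun C hC => ?_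
      obtain ⟨v, -, q, hq, rfl⟩ := (memt C).1 hC
      exact comp_card q (Finset.mem_inter.1 hq).2
    have hdisj : Disjoint A' Q :=
      (hPD.symm.mono_left hA'D).mono_right hQP
    have hAQ : ∀ v ∈ A', G.neighborFinset v ∩ P ⊆ G.neighborFinset v ∩ Q := by
      intro v hv q hq
      refine Finset.mem_inter.2 ⟨(Finset.mem_inter.1 hq).1, (memQ q).2 ⟨v, hv, q, hq, ?_⟩⟩
      exact Finset.mem_insert_self _ _
    -- the two orders of counting the edges between `A'` and `Q`
    have hcross : ∑ v ∈ A', (G.neighborFinset v ∩ Q).card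
        = ∑ q ∈ Q, (G.neighborFinset q ∩ A').card := by
      have := Finset.sum_card_bipartiteAbove_eq_sum_card_bipartiteBelow
        (s := A') (t := Q) G.Adj
      convert this using 3 with v _ q _
      · ext a; simp [Finset.bipartiteAbove, and_comm]
      · ext a; simp [Finset.bipartiteBelow, and_comm, G.adj_comm]
    have hlow : 2 * A'.card ≤ ∑ v ∈ A', (G.neighborFinset v ∩ Q).card := by
      rw [mul_comm, ← smul_eq_mul]
      exact Finset.card_nsmul_le_sum _ _ _ fun v hv =>
        (hD2 v (hA'D v hv)).trans (Finset.card_le_card (hAQ v hv))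
    have hmatch : Q.card ≤ ∑ q ∈ Q, (G.neighborFinset q ∩ Q).card := by
      rw [Finset.card_eq_sum_ones]
      refine Finset.sum_le_sum fun r hr => Finset.card_pos.2 ?_
      obtain ⟨v, hv, q, hq, hrq⟩ := (memQ r).1 hr
      have inQ : ∀ z ∈ comp q, z ∈ Q := fun z hz => (memQ z).2 ⟨v, hv, q, hq, hz⟩
      rcases Finset.mem_insert.1 hrq with rfl | h
      · obtain ⟨z, hz⟩ := hDm v (hA'D v hv) r hq
        exact ⟨z, Finset.mem_inter.2
          ⟨(Finset.mem_inter.1 hz).1, inQ z (Finset.mem_insert_of_mem hz)⟩⟩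
      · refine ⟨q, Finset.mem_inter.2 ⟨?_, inQ q (Finset.mem_insert_self _ _)⟩⟩
        simpa [G.adj_comm] using (Finset.mem_inter.1 h).1
    -- Cross edges count twice in the degree sum and every vertex of `Q` has a neighbour in `Q`, so
    -- `4|A'| + |Q| ≤ 2|A'| + 2|Q|`. Thus `2|A'| ≤ |Q|`, which is at most twice the number of
    -- components.
    have htot := sum_card_neighborFinset_inter_le hG (A' ∪ Q)
    have hsplit : ∀ v, (G.neighborFinset v ∩ (A' ∪ Q)).card
        = (G.neighborFinset v ∩ A').card + (G.neighborFinset v ∩ Q).card := by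
      intro v
      rw [Finset.inter_union_distrib_left, Finset.card_union_of_disjoint]
      exact (hdisj.mono_left Finset.inter_subset_right).mono_right Finset.inter_subset_right
    rw [Finset.sum_union hdisj, Finset.card_union_of_disjoint hdisj] at htot
    simp only [hsplit, Finset.sum_add_distrib] at htot
    omega
  obtain ⟨f, hf, hft⟩ := (Finset.all_card_le_biUnion_card_iff_exists_injective t).1 hall
  have hch : ∀ v : D, ∃ q ∈ G.neighborFinset (v : V) ∩ P, comp q = f v := fun v =>
    Finset.mem_image.1 (hft v)
  choose g hg hgf using hch
  have hgP : ∀ v, g v ∈ P := fun v => (Finset.mem_inter.1 (hg v)).2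
  refine ⟨Finset.univ.image g, ?_, ?_, ?_⟩
  · intro q hq
    obtain ⟨v, -, rfl⟩ := Finset.mem_image.1 hq
    exact hgP v
  · intro a ha b hb _ hadj
    obtain ⟨v, -, rfl⟩ := Finset.mem_image.1 (Finset.mem_coe.1 ha)
    obtain ⟨w, -, rfl⟩ := Finset.mem_image.1 (Finset.mem_coe.1 hb)
    -- Adjacent representatives share a component, which injectivity of the assignment forbids for
    -- distinct vertices of `D`.
    have h1 := comp_eq _ (hgP v) _ (hgP w) hadj
    rw [hgf, hgf] at h1
    rw [hf h1] at hadj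
    exact G.loopless.irrefl _ hadj
  · intro v hv
    refine ⟨g ⟨v, hv⟩, Finset.mem_image_of_mem _ (Finset.mem_univ _), ?_⟩
    simpa using (Finset.mem_inter.1 (hg ⟨v, hv⟩)).1

end Forest

/-! ### Greedy rounding to an independent set -/

section Greedy

variable {V : Type*} [DecidableEq V]

/-- A greedy bound for the weighted independence number: if the nonnegative vertex weights `y` have
sum at most one over all closed neighbourhoods in `P`, then `P` contains an independent set whose
`w`-weight is at least the `y`-average of `w`. -/
theorem exists_indep_sum_mul_le_sum (G : SimpleGraph V) [DecidableRel G.Adj] (w y : V → ℝ)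
    (hw : ∀ i, 0 ≤ w i) (P : Finset V) (hy : ∀ i ∈ P, 0 < y i)
    (hsum : ∀ i ∈ P, ∑ j ∈ P with i = j ∨ G.Adj i j, y j ≤ 1) :
    ∃ I ⊆ P, G.IsIndepSet (I : Set V) ∧ ∑ i ∈ P, w i * y i ≤ ∑ i ∈ I, w i := by
  induction P using Finset.strongInduction with
  | H P ih =>
    rcases P.eq_empty_or_nonempty with rfl | hne
    · exact ⟨∅, by simp⟩
    obtain ⟨v, hv, hwv⟩ : ∃ v ∈ P, ∑ i ∈ P with v = i ∨ G.Adj v i, w i * y i ≤ w v := by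
      -- Otherwise average the reversed inequalities with weights `y v`. Exchanging the sums by
      -- symmetry of adjacency bounds the right side by `∑ y i * w i`, which is the left side.
      by_contra! h
      have h1 : ∑ v ∈ P, y v * w v
          < ∑ v ∈ P, y v * ∑ i ∈ P with v = i ∨ G.Adj v i, w i * y i :=
        Finset.sum_lt_sum_of_nonempty hne fun v hv =>
          mul_lt_mul_of_pos_left (h v hv) (hy v hv)
      have h2 : ∑ v ∈ P, y v * ∑ i ∈ P with v = i ∨ G.Adj v i, w i * y i
          = ∑ i ∈ P, (y i * w i) * ∑ j ∈ P with i = j ∨ G.Adj i j, y j := by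
        simp only [Finset.mul_sum, Finset.sum_filter]
        rw [Finset.sum_comm]
        refine Finset.sum_congr rfl fun i _ => Finset.sum_congr rfl fun j _ => ?_
        simp only [G.adj_comm i j, eq_comm (a := i) (b := j)]
        split_ifs <;> ring
      have h3 : ∑ i ∈ P, (y i * w i) * ∑ j ∈ P with i = j ∨ G.Adj i j, y j
          ≤ ∑ i ∈ P, y i * w i :=
        Finset.sum_le_sum fun i hi =>
          mul_le_of_le_one_right (mul_nonneg (hy i hi).le (hw i)) (hsum i hi)
      linarith
    set P' : Finset V := {i ∈ P | ¬(v = i ∨ G.Adj v i)} with hP'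
    have hsub : P' ⊆ P := Finset.filter_subset _ _
    obtain ⟨I, hI, hind, hIw⟩ := ih P'
      (Finset.ssubset_iff_subset_ne.2 ⟨hsub, fun h => by
        have : v ∈ P' := h ▸ hv
        simp [hP'] at this⟩)
      (fun i hi => hy i (hsub hi))
      (fun i hi => (Finset.sum_le_sum_of_subset_of_nonneg
        (Finset.filter_subset_filter _ hsub)
        fun j hj _ => (hy j (Finset.mem_filter.1 hj).1).le).trans (hsum i (hsub hi)))
    have hvI : ∀ i ∈ I, ¬(v = i ∨ G.Adj v i) := fun i hi => (Finset.mem_filter.1 (hI hi)).2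
    have hvnot : v ∉ I := fun h => hvI v h (Or.inl rfl)
    refine ⟨insert v I, Finset.insert_subset hv (hI.trans hsub), ?_, ?_⟩
    · rw [Finset.coe_insert]
      refine Set.Pairwise.insert hind fun i hi _ => ?_
      have := hvI i hi
      push Not at this
      exact ⟨this.2, fun h => this.2 h.symm⟩
    · rw [Finset.sum_insert hvnot,
        ← Finset.sum_filter_add_sum_filter_not P (fun i => v = i ∨ G.Adj v i)]
      exact add_le_add hwv hIw

end Greedy

/-! ### Bounds for benefit functions -/

section Benefit

variable {b : ℝ → ℝ} {c e B : ℝ}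

theorem IsBenefit.strictAntiOn_deriv (hb : IsBenefit b) : StrictAntiOn (deriv b) (Set.Ici 0) := by
  refine strictAntiOn_of_deriv_neg (convex_Ici 0) (fun y hy => ?_) fun y hy => ?_
  · exact (differentiableAt_of_deriv_ne_zero
      (hb.deriv_deriv_neg y hy).ne).continuousAt.continuousWithinAt
  · rw [interior_Ici] at hy
    exact hb.deriv_deriv_neg y (le_of_lt hy)

theorem IsBenefit.strictConcaveOn (hb : IsBenefit b) : StrictConcaveOn ℝ (Set.Ici 0) b :=
  (hb.strictAntiOn_deriv.mono interior_subset).strictConcaveOn_of_deriv (convex_Ici 0)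
    hb.differentiable.continuous.continuousOn

theorem IsBenefit.strictMonoOn (hb : IsBenefit b) : StrictMonoOn b (Set.Ici 0) := by
  refine strictMonoOn_of_deriv_pos (convex_Ici 0) hb.differentiable.continuous.continuousOn
    fun y hy => ?_
  rw [interior_Ici] at hy
  exact hb.deriv_pos y (le_of_lt hy)

theorem hasDerivAt_netBenefit (hb : IsBenefit b) (c y : ℝ) :
    HasDerivAt (fun z => b z - c * z) (deriv b y - c) y := by
  simpa using (hb.differentiable y).hasDerivAt.fun_sub ((hasDerivAt_id y).const_mul c)

/-- The derivative `b' - c` is strictly decreasing and vanishes at `e`; together with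
`strictAntiOn_netBenefit` this makes `e` the unique peak on the nonnegative half-line. -/
theorem strictMonoOn_netBenefit (he : 0 < e) (hb : b ∈ benefitFamily c e B) :
    StrictMonoOn (fun z => b z - c * z) (Set.Icc 0 e) := by
  obtain ⟨hb, -, hc⟩ := hb
  refine strictMonoOn_of_deriv_pos (convex_Icc 0 e)
    (fun y _ => (hasDerivAt_netBenefit hb c y).continuousAt.continuousWithinAt) fun y hy => ?_
  rw [interior_Icc] at hy
  have := hb.strictAntiOn_deriv (Set.mem_Ici.2 hy.1.le) (Set.mem_Ici.2 he.le) hy.2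
  rw [(hasDerivAt_netBenefit hb c y).deriv]
  linarith

theorem strictAntiOn_netBenefit (he : 0 < e) (hb : b ∈ benefitFamily c e B) :
    StrictAntiOn (fun z => b z - c * z) (Set.Ici e) := by
  obtain ⟨hb, -, hc⟩ := hb
  refine strictAntiOn_of_deriv_neg (convex_Ici e)
    (fun y _ => (hasDerivAt_netBenefit hb c y).continuousAt.continuousWithinAt) fun y hy => ?_
  rw [interior_Ici] at hy
  have hy : e < y := hy
  have := hb.strictAntiOn_deriv (Set.mem_Ici.2 he.le) (Set.mem_Ici.2 (he.trans hy).le) hy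
  rw [(hasDerivAt_netBenefit hb c y).deriv]
  linarith

/-- Beyond `e`, a benefit function lies below its tangent at `e`. -/
theorem benefit_le_tangent (he : 0 < e) (hb : b ∈ benefitFamily c e B) {y : ℝ} (hy : e ≤ y) :
    b y ≤ B + c * (y - e) := by
  have h := (strictAntiOn_netBenefit he hb).antitoneOn Set.self_mem_Ici (Set.mem_Ici.2 hy) hy
  simp only [hb.2.1] at h
  linarith

/-- Between `e` and `n e`, a benefit function lies above its chord, whose slope is `σ c`. -/
theorem chord_le_benefit {n : ℕ} (hn : 2 ≤ n) (hc : 0 < c) (he : 0 < e)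
    (hb : b ∈ benefitFamily c e B) {y : ℝ} (hy : e ≤ y) (hyn : y ≤ n * e) :
    B + concavity n c e b * c * (y - e) ≤ b y := by
  have hn' : (0 : ℝ) < (n : ℝ) - 1 := by
    have : (2 : ℝ) ≤ n := by exact_mod_cast hn
    linarith
  -- The barycentric coordinate of `y` on the segment from `e` to `n e`.
  set s := (y - e) / (e * ((n : ℝ) - 1)) with hs
  have hpos : 0 < e * ((n : ℝ) - 1) := mul_pos he hn'
  have hs0 : 0 ≤ s := div_nonneg (by linarith) hpos.le
  have hs1 : s ≤ 1 := (div_le_one hpos).2 (by linarith)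
  have h := hb.1.strictConcaveOn.concaveOn.2 (x := e) (y := n * e) (Set.mem_Ici.2 he.le)
    (Set.mem_Ici.2 (by positivity)) (sub_nonneg.2 hs1) hs0 (by ring)
  have hy' : (1 - s) • e + s • ((n : ℝ) * e) = y := by
    simp only [smul_eq_mul, hs]; field_simp; ring
  rw [hy', hb.2.1, smul_eq_mul, smul_eq_mul] at h
  have : concavity n c e b * c * (y - e) = s * (b (n * e) - B) := by
    rw [concavity, hb.2.1, hs]; field_simp
  linarith

/-- By monotonicity the gain beyond `e` is at most the total rise up to `n e`, which `σ` measures.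
-/
theorem benefit_le_add_concavity {n : ℕ} (hn : 2 ≤ n) (hc : 0 < c) (he : 0 < e)
    (hb : b ∈ benefitFamily c e B) {y : ℝ} (hy : e ≤ y) (hyn : y ≤ n * e) :
    b y ≤ B + concavity n c e b * (c * e * (n - 1)) := by
  have hn' : (0 : ℝ) < (n : ℝ) - 1 := by
    have : (2 : ℝ) ≤ n := by exact_mod_cast hn
    linarith
  have h := hb.1.strictMonoOn.monotoneOn (Set.mem_Ici.2 (he.le.trans hy))
    (Set.mem_Ici.2 (he.le.trans (hy.trans hyn))) hyn
  have h2 : concavity n c e b * (c * e * (n - 1)) = b (n * e) - b e := by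
    rw [concavity]; field_simp
  rw [h2, hb.2.1]
  linarith

theorem le_benefit (he : 0 < e) (hb : b ∈ benefitFamily c e B) {y : ℝ} (hy : e ≤ y) : B ≤ b y :=
  hb.2.1 ▸ hb.1.strictMonoOn.monotoneOn (Set.mem_Ici.2 he.le) (Set.mem_Ici.2 (he.le.trans hy)) hy

theorem concavity_le_one {n : ℕ} (hn : 2 ≤ n) (hc : 0 < c) (he : 0 < e)
    (hb : b ∈ benefitFamily c e B) : concavity n c e b ≤ 1 := by
  have hn' : (1 : ℝ) < (n : ℝ) := by exact_mod_cast hn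
  have := benefit_le_tangent he hb (y := n * e) (by nlinarith)
  rw [concavity, hb.2.1, div_le_one (mul_pos (mul_pos hc he) (by linarith))]
  linarith

end Benefit

/-! ### Benefit functions with concavity near 0 and near 1 -/

section ExponentialBenefit

/-- The benefit function with constant relative curvature `k`. -/
noncomputable def expBenefit (c e B k : ℝ) (y : ℝ) : ℝ :=
  B + c / k * (1 - Real.exp (-(k * (y - e))))

variable {c e B k : ℝ}

theorem hasDerivAt_exp_decay (k e y : ℝ) :
    HasDerivAt (fun y => Real.exp (-(k * (y - e)))) (-k * Real.exp (-(k * (y - e)))) y := by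
  have h : HasDerivAt (fun y : ℝ => -(k * (y - e))) (-k) y := by
    simpa using (((hasDerivAt_id y).sub_const e).const_mul k).fun_neg
  simpa [mul_comm] using h.exp

theorem hasDerivAt_expBenefit (c e B : ℝ) (hk : 0 < k) (y : ℝ) :
    HasDerivAt (expBenefit c e B k) (c * Real.exp (-(k * (y - e)))) y := by
  have h := (((hasDerivAt_exp_decay k e y).const_sub 1).const_mul (c / k)).const_add B
  exact h.congr_deriv (by field_simp)

theorem expBenefit_mem (e B : ℝ) (hc : 0 < c) (hk : 0 < k) :
    expBenefit c e B k ∈ benefitFamily c e B := by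
  have hd : deriv (expBenefit c e B k) = fun y => c * Real.exp (-(k * (y - e))) :=
    funext fun y => (hasDerivAt_expBenefit c e B hk y).deriv
  refine ⟨⟨fun y => (hasDerivAt_expBenefit c e B hk y).differentiableAt, fun y _ => ?_,
    fun y _ => ?_⟩, ?_, ?_⟩
  · rw [hd]; positivity
  · rw [hd, ((hasDerivAt_exp_decay k e y).const_mul c).deriv]
    have : 0 < c * (k * Real.exp (-(k * (y - e)))) := by positivity
    linarith
  · simp [expBenefit]
  · simp [hd]

/-- The curvature is scaled so that the exponent at `n e` is `-t`. The concavity becomes a function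
of `t` alone, tending to `1` as `t → 0⁺` and to `0` as `t → ∞`. -/
theorem concavity_expBenefit {n : ℕ} (hn : 2 ≤ n) (B : ℝ) (hc : 0 < c) (he : 0 < e) {t : ℝ}
    (ht : 0 < t) : concavity n c e (expBenefit c e B (t / (e * ((n : ℝ) - 1))))
      = (1 - Real.exp (-t)) / t := by
  have hn' : (0 : ℝ) < (n : ℝ) - 1 := by
    have : (2 : ℝ) ≤ n := by exact_mod_cast hn
    linarith
  have h : t / (e * ((n : ℝ) - 1)) * (n * e - e) = t := by field_simp
  simp only [concavity, expBenefit, h]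
  simp only [sub_self, mul_zero, neg_zero, Real.exp_zero, add_zero]
  field_simp
  ring

theorem concavityTo_neBot {n : ℕ} (hn : 2 ≤ n) (B : ℝ) (hc : 0 < c) (he : 0 < e) {l : Filter ℝ}
    [l.NeBot] (hl : ∀ᶠ t in l, 0 < t) {s : ℝ}
    (hs : Tendsto (fun t => (1 - Real.exp (-t)) / t) l (𝓝 s)) :
    (concavityTo n c e B s).NeBot := by
  have hn' : (0 : ℝ) < (n : ℝ) - 1 := by
    have : (2 : ℝ) ≤ n := by exact_mod_cast hn
    linarith
  have h : Tendsto (fun t => expBenefit c e B (t / (e * ((n : ℝ) - 1)))) l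
      (concavityTo n c e B s) := by
    refine tendsto_inf.2 ⟨tendsto_comap_iff.2 (hs.congr' ?_), tendsto_principal.2 ?_⟩
    · filter_upwards [hl] with t ht
      exact (concavity_expBenefit hn B hc he ht).symm
    · filter_upwards [hl] with t ht
      exact expBenefit_mem e B hc (by positivity)
  exact h.neBot

theorem tendsto_one_sub_exp_neg_div_atTop :
    Tendsto (fun t => (1 - Real.exp (-t)) / t) atTop (𝓝 0) := by
  have h : Tendsto (fun t => 1 - Real.exp (-t)) atTop (𝓝 (1 - 0)) :=
    tendsto_const_nhds.sub Real.tendsto_exp_neg_atTop_nhds_zero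
  exact h.div_atTop tendsto_id

theorem tendsto_one_sub_exp_neg_div_zero :
    Tendsto (fun t => (1 - Real.exp (-t)) / t) (𝓝[>] 0) (𝓝 1) := by
  have h : HasDerivAt (fun t : ℝ => 1 - Real.exp (-t)) 1 0 := by
    simpa using (hasDerivAt_neg (0 : ℝ)).exp.const_sub 1
  have h1 := (hasDerivAt_iff_tendsto_slope.1 h).mono_left
    (nhdsWithin_mono 0 fun t (ht : 0 < t) => ne_of_gt ht)
  refine h1.congr fun t => ?_
  simp [slope_def_field]

theorem concavityTo_one_neBot {n : ℕ} (hn : 2 ≤ n) (B : ℝ) (hc : 0 < c) (he : 0 < e) :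
    (concavityTo n c e B 1).NeBot :=
  concavityTo_neBot hn B hc he (eventually_mem_nhdsWithin (s := Set.Ioi 0))
    tendsto_one_sub_exp_neg_div_zero

theorem concavityTo_zero_neBot {n : ℕ} (hn : 2 ≤ n) (B : ℝ) (hc : 0 < c) (he : 0 < e) :
    (concavityTo n c e B 0).NeBot :=
  concavityTo_neBot hn B hc he (eventually_gt_atTop 0) tendsto_one_sub_exp_neg_div_atTop

end ExponentialBenefit

/-! ### Equilibria as complementary profiles -/

section Equilibrium

variable {V : Type*} [Fintype V] {G : SimpleGraph V} [DecidableRel G.Adj]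
variable {c e B : ℝ} {b : ℝ → ℝ} {x : V → ℝ}

variable (G) in
/-- The complementarity conditions which characterize the equilibria. -/
def IsComplementary (e : ℝ) (x : V → ℝ) : Prop :=
  ∀ i, 0 ≤ x i ∧ e ≤ closedEffort G x i ∧ (x i = 0 ∨ closedEffort G x i = e)

/-- The last term is beyond the control of agent `i`, who therefore just maximizes the net benefit
of the closed effort. -/
theorem utility_eq (x : V → ℝ) (i : V) :
    utility G c b x i = (b (closedEffort G x i) - c * closedEffort G x i)
        + c * ∑ j ∈ G.neighborFinset i, x j := by
  simp only [utility, closedEffort]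
  ring

theorem IsComplementary.le (he : 0 < e) (hx : IsComplementary G e x) (i : V) : x i ≤ e := by
  obtain ⟨-, -, h | h⟩ := hx i
  · rw [h]; exact he.le
  · rw [← h, closedEffort]
    linarith [Finset.sum_nonneg fun j (_ : j ∈ G.neighborFinset i) => (hx j).1]

theorem continuous_welfare (hb : Continuous b) : Continuous (welfare G c b) := by
  unfold welfare utility closedEffort
  fun_prop

theorem exists_isMaximalIndepSet (G : SimpleGraph V) : ∃ S, IsMaximalIndepSet G S := by
  obtain ⟨S, -, hS⟩ := Finite.exists_le_maximal
    (p := fun T : Finset V => G.IsIndepSet (T : Set V)) (a := ∅) (by simp)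
  exact ⟨S, hS⟩

theorem isCompact_setOf_isComplementary (he : 0 < e) : IsCompact {x | IsComplementary G e x} := by
  have hcont : ∀ i, Continuous fun x : V → ℝ => closedEffort G x i := fun i => by
    unfold closedEffort; fun_prop
  refine (isCompact_univ_pi fun _ : V => isCompact_Icc (a := (0 : ℝ)) (b := e)).of_isClosed_subset
    ?_ fun x hx i _ => ⟨(hx i).1, hx.le he i⟩
  simp only [IsComplementary, Set.ofPred_forall, Set.ofPred_and, Set.ofPred_or]
  refine isClosed_iInter fun i => ?_
  exact (isClosed_le continuous_const (continuous_apply i)).inter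
    ((isClosed_le continuous_const (hcont i)).inter
      ((isClosed_eq (continuous_apply i) continuous_const).union
        (isClosed_eq (hcont i) continuous_const)))

variable [DecidableEq V]

theorem utility_update (x : V → ℝ) (i : V) (y : ℝ) :
    utility G c b (Function.update x i y) i
      = (b (y + ∑ j ∈ G.neighborFinset i, x j) - c * (y + ∑ j ∈ G.neighborFinset i, x j))
        + c * ∑ j ∈ G.neighborFinset i, x j := by
  have h : ∑ j ∈ G.neighborFinset i, Function.update x i y j = ∑ j ∈ G.neighborFinset i, x j :=
    Finset.sum_congr rfl fun j hj => Function.update_of_ne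
      (by rintro rfl; simp at hj) _ _
  simp only [utility, closedEffort, h, Function.update_self]
  ring

/-- A profile is an equilibrium iff it satisfies the complementarity conditions; in particular, the
equilibria do not depend on the benefit function. -/
theorem mem_NE_iff (he : 0 < e) (hb : b ∈ benefitFamily c e B) :
    x ∈ NE G c b ↔ IsComplementary G e x := by
  have hmono := strictMonoOn_netBenefit he hb
  have hanti := strictAntiOn_netBenefit he hb
  constructor
  · rintro ⟨h0, h⟩ i
    have hs0 : 0 ≤ ∑ j ∈ G.neighborFinset i, x j := Finset.sum_nonneg fun j _ => h0 j
    have hi := h i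
    simp only [utility_update, utility_eq x i, add_le_add_iff_right] at hi
    have hcl : closedEffort G x i = x i + ∑ j ∈ G.neighborFinset i, x j := rfl
    have hx0 := h0 i
    set s := ∑ j ∈ G.neighborFinset i, x j
    have hle : e ≤ closedEffort G x i := by
      by_contra! hlt
      -- Raising the own effort until the closed effort is exactly `e` would be profitable.
      have h1 := hi (e - s) (by linarith)
      rw [sub_add_cancel] at h1
      exact absurd h1 (not_le.2 (hmono ⟨by linarith, hlt.le⟩ ⟨he.le, le_rfl⟩ hlt))
    refine ⟨hx0, hle, ?_⟩
    by_contra! hne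
    have hxpos : 0 < x i := lt_of_le_of_ne hx0 hne.1.symm
    have hgt : e < closedEffort G x i := lt_of_le_of_ne hle hne.2.symm
    -- The best response to `s`: it lowers the closed effort, but not below `e`.
    have h1 := hi (max 0 (e - s)) (le_max_left _ _)
    have h2 : e ≤ max 0 (e - s) + s := by linarith [le_max_right 0 (e - s)]
    have h3 : max 0 (e - s) + s < closedEffort G x i := by
      rcases max_cases 0 (e - s) with h | h <;> linarith
    exact absurd h1 (not_le.2 (hanti (Set.mem_Ici.2 h2) (Set.mem_Ici.2 hle) h3))
  · intro h
    refine ⟨fun i => (h i).1, fun i y hy => ?_⟩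
    obtain ⟨hx0, hle, hor⟩ := h i
    have hs0 : 0 ≤ ∑ j ∈ G.neighborFinset i, x j := Finset.sum_nonneg fun j _ => (h j).1
    rw [utility_update, utility_eq x i, add_le_add_iff_right]
    rcases hor with h1 | h1
    · rw [closedEffort, h1, zero_add] at hle ⊢
      exact hanti.antitoneOn (Set.mem_Ici.2 hle) (Set.mem_Ici.2 (by linarith)) (by linarith)
    · rw [h1]
      rcases le_total (y + ∑ j ∈ G.neighborFinset i, x j) e with h2 | h2
      · exact hmono.monotoneOn ⟨by linarith, h2⟩ ⟨he.le, le_rfl⟩ h2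
      · exact hanti.antitoneOn Set.self_mem_Ici (Set.mem_Ici.2 h2) h2

theorem closedEffort_eq_sum_insert (x : V → ℝ) (i : V) :
    closedEffort G x i = ∑ j ∈ insert i (G.neighborFinset i), x j := by
  rw [Finset.sum_insert (by simp), closedEffort]

/-- This keeps closed efforts in the range where `σ` controls `b`. -/
theorem IsComplementary.closedEffort_le (he : 0 < e) (hx : IsComplementary G e x) (i : V) :
    closedEffort G x i ≤ Fintype.card V * e := by
  rw [closedEffort_eq_sum_insert]
  calc _ ≤ ∑ j, x j :=
        Finset.sum_le_sum_of_subset_of_nonneg (Finset.subset_univ _) fun j _ _ => (hx j).1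
    _ ≤ ∑ _j : V, e := Finset.sum_le_sum fun j _ => hx.le he j
    _ = _ := by simp

/-- A set of vertices is a maximal independent set iff it is independent and dominating. -/
theorem isMaximalIndepSet_iff {V : Type*} [DecidableEq V] {G : SimpleGraph V} {S : Finset V} :
    IsMaximalIndepSet G S ↔
      G.IsIndepSet (S : Set V) ∧ ∀ v ∉ S, ∃ s ∈ S, G.Adj v s := by
  constructor
  · rintro ⟨h, hmax⟩
    refine ⟨h, fun v hv => ?_⟩
    by_contra! hno
    refine hv (hmax (y := insert v S) ?_ (Finset.subset_insert _ _) (Finset.mem_insert_self _ _))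
    change G.IsIndepSet _
    rw [Finset.coe_insert]
    exact Set.Pairwise.insert h fun s hs _ => ⟨hno s hs, fun h' => hno s hs h'.symm⟩
  · rintro ⟨h, hdom⟩
    refine ⟨h, fun T hT hST v hv => ?_⟩
    by_contra hvS
    obtain ⟨s, hs, hadj⟩ := hdom v hvS
    exact hT hv (hST hs) hadj.ne hadj

theorem closedEffort_specialistProfile (S : Finset V) (i : V) :
    closedEffort G (specialistProfile e S) i
      = (if i ∈ S then e else 0) + (G.neighborFinset i ∩ S).card * e := by
  simp only [closedEffort, specialistProfile, ← Finset.sum_filter, Finset.sum_const, nsmul_eq_mul,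
    Finset.filter_mem_eq_inter]

theorem isComplementary_specialistProfile (he : 0 < e) {S : Finset V}
    (hS : IsMaximalIndepSet G S) : IsComplementary G e (specialistProfile e S) := by
  obtain ⟨hind, hdom⟩ := isMaximalIndepSet_iff.1 hS
  intro i
  rw [closedEffort_specialistProfile]
  by_cases hi : i ∈ S
  · have h0 : G.neighborFinset i ∩ S = ∅ := by
      refine Finset.eq_empty_of_forall_notMem fun j hj => ?_
      simp only [Finset.mem_inter, SimpleGraph.mem_neighborFinset] at hj
      exact hind hi hj.2 hj.1.ne hj.1
    simp [specialistProfile, hi, h0, he.le]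
  · obtain ⟨s, hs, hadj⟩ := hdom i hi
    have h1 : (1 : ℝ) ≤ (G.neighborFinset i ∩ S).card := by
      exact_mod_cast Finset.card_pos.2 ⟨s, by simp [hadj, hs]⟩
    refine ⟨by simp [specialistProfile, hi], ?_, Or.inl (by simp [specialistProfile, hi])⟩
    rw [if_neg hi, zero_add]
    exact le_mul_of_one_le_left he.le h1

theorem specialistProfile_mem_SNE (he : 0 < e) (hb : b ∈ benefitFamily c e B) {S : Finset V}
    (hS : IsMaximalIndepSet G S) : specialistProfile e S ∈ SNE G c e b := by
  refine ⟨(mem_NE_iff he hb).2 (isComplementary_specialistProfile he hS), fun i => ?_⟩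
  by_cases hi : i ∈ S <;> simp [specialistProfile, hi]

/-- The specialized equilibria are the profiles of the maximal independent sets. -/
theorem exists_eq_specialistProfile (he : 0 < e) (hx : IsComplementary G e x)
    (hs : ∀ i, x i = 0 ∨ x i = e) : ∃ S, IsMaximalIndepSet G S ∧ x = specialistProfile e S := by
  have hxS : x = specialistProfile e (Finset.univ.filter fun i => x i = e) := by
    ext i
    rcases hs i with h | h <;> simp [specialistProfile, h, he.ne]
  refine ⟨_, isMaximalIndepSet_iff.2 ⟨?_, ?_⟩, hxS⟩
  · intro i hi j hj _ hadj
    simp only [Finset.coe_filter, Finset.mem_univ, true_and, Set.mem_ofPred_eq] at hi hj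
    obtain ⟨-, -, h | h⟩ := hx i
    · exact he.ne (h.symm.trans hi)
    · have := Finset.single_le_sum (f := x) (fun k _ => (hx k).1)
        ((SimpleGraph.mem_neighborFinset ..).2 hadj)
      rw [closedEffort] at h
      linarith
  · intro v hv
    simp only [Finset.mem_filter, Finset.mem_univ, true_and] at hv ⊢
    by_contra! hno
    have h0 : x v = 0 := (hs v).resolve_right hv
    have h1 : ∑ j ∈ G.neighborFinset v, x j = 0 := Finset.sum_eq_zero fun j hj =>
      (hs j).resolve_right fun h => hno j h ((SimpleGraph.mem_neighborFinset ..).1 hj)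
    have := (hx v).2.1
    rw [closedEffort, h0, h1] at this
    linarith

theorem sum_specialistProfile (S : Finset V) : ∑ i, specialistProfile e S i = e * S.card := by
  simp [specialistProfile, mul_comm]

/-- The maximum of the welfare over the equilibria is attained. -/
theorem isGreatest_maxWelfare (he : 0 < e) (hb : b ∈ benefitFamily c e B) :
    IsGreatest (welfare G c b '' NE G c b) (maxWelfare G c b) := by
  obtain ⟨S, hS⟩ := exists_isMaximalIndepSet G
  have hNE : NE G c b = {x | IsComplementary G e x} := Set.ext fun x => mem_NE_iff he hb
  refine (IsCompact.image ?_ (continuous_welfare hb.1.differentiable.continuous)).isGreatest_sSup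
    ⟨_, _, (specialistProfile_mem_SNE he hb hS).1, rfl⟩
  rw [hNE]
  exact isCompact_setOf_isComplementary he

/-- The maximum of the welfare over the specialized equilibria is attained. -/
theorem isGreatest_maxSpecializedWelfare (he : 0 < e) (hb : b ∈ benefitFamily c e B) :
    IsGreatest (welfare G c b '' SNE G c e b) (maxSpecializedWelfare G c e b) := by
  obtain ⟨S, hS⟩ := exists_isMaximalIndepSet G
  have hfin : (SNE G c e b).Finite := by
    refine (Set.finite_range fun S : Finset V => specialistProfile e S).subset fun x hx => ?_
    obtain ⟨S, -, rfl⟩ := exists_eq_specialistProfile he ((mem_NE_iff he hb).1 hx.1) hx.2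
    exact ⟨S, rfl⟩
  exact (hfin.image _).isCompact.isGreatest_sSup
    ⟨_, _, specialistProfile_mem_SNE he hb hS, rfl⟩

theorem le_maxSpecializedWelfare (he : 0 < e) (hb : b ∈ benefitFamily c e B)
    (hx : x ∈ SNE G c e b) : welfare G c b x ≤ maxSpecializedWelfare G c e b :=
  (isGreatest_maxSpecializedWelfare he hb).2 ⟨x, hx, rfl⟩

theorem maxSpecializedWelfare_le_maxWelfare (he : 0 < e) (hb : b ∈ benefitFamily c e B) :
    maxSpecializedWelfare G c e b ≤ maxWelfare G c b := by
  obtain ⟨x, hx, h⟩ := (isGreatest_maxSpecializedWelfare (G := G) he hb).1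
  exact h ▸ (isGreatest_maxWelfare he hb).2 ⟨x, hx.1, rfl⟩

end Equilibrium

/-! ### Rounding equilibria to specialized ones -/

section Rounding

variable {V : Type*} [Fintype V] [DecidableEq V] {G : SimpleGraph V} [DecidableRel G.Adj]
variable {e : ℝ} {x : V → ℝ}

theorem closedEffort_eq_add_sum_inter {P : Finset V} (hP : ∀ i ∉ P, x i = 0) (i : V) :
    closedEffort G x i = x i + ∑ j ∈ G.neighborFinset i ∩ P, x j := by
  rw [closedEffort, Finset.sum_subset Finset.inter_subset_left fun j hj hj' =>
    hP j fun h => hj' (Finset.mem_inter.2 ⟨hj, h⟩)]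

/-- A complementary profile has at most the weight of some independent set. -/
theorem IsComplementary.exists_indep_sum_mul_le (he : 0 < e) (hx : IsComplementary G e x)
    {w : V → ℝ} (hw : ∀ i, 0 ≤ w i) :
    ∃ I : Finset V, G.IsIndepSet (I : Set V) ∧ ∑ i, w i * x i ≤ e * ∑ i ∈ I, w i := by
  set P : Finset V := {i | 0 < x i} with hP
  have hP0 : ∀ i ∉ P, x i = 0 := fun i hi =>
    le_antisymm (by simpa [hP] using hi) (hx i).1
  -- Active agents have closed effort exactly `e`, so dividing by `e` gives closed sums equal to one
  -- on the support.
  obtain ⟨I, -, hI, hle⟩ := exists_indep_sum_mul_le_sum G w (fun i => x i / e) hw P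
    (fun i hi => div_pos (by simpa [hP] using hi) he) (fun i hi => by
      have hset : ({j ∈ P | i = j ∨ G.Adj i j} : Finset V)
          = insert i (G.neighborFinset i ∩ P) := by
        ext j
        simp only [Finset.mem_filter, Finset.mem_insert, Finset.mem_inter,
          SimpleGraph.mem_neighborFinset]
        constructor
        · rintro ⟨h, rfl | h'⟩ <;> tauto
        · rintro (rfl | h) <;> tauto
      rw [hset, ← Finset.sum_div, Finset.sum_insert (by simp),
        ← closedEffort_eq_add_sum_inter hP0, div_le_one he]
      have hi0 : 0 < x i := by simpa [hP] using hi
      exact ((hx i).2.2.resolve_left hi0.ne').le)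
  refine ⟨I, hI, ?_⟩
  calc ∑ i, w i * x i = ∑ i ∈ P, w i * x i :=
        (Finset.sum_subset (Finset.subset_univ _) fun i _ hi => by rw [hP0 i hi, mul_zero]).symm
    _ = e * ∑ i ∈ P, w i * (x i / e) := by
        rw [Finset.mul_sum]
        exact Finset.sum_congr rfl fun i _ => by field_simp
    _ ≤ e * ∑ i ∈ I, w i := mul_le_mul_of_nonneg_left hle he.le

/-- In a forest, a complementary profile has at least the total effort of some specialized
profile. -/
theorem IsComplementary.exists_isMaximalIndepSet_card_le (hG : G.IsAcyclic) (he : 0 < e)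
    (hx : IsComplementary G e x) : ∃ S, IsMaximalIndepSet G S ∧ e * S.card ≤ ∑ i, x i := by
  set P : Finset V := {i | 0 < x i} with hP
  have hpos : ∀ i ∈ P, 0 < x i := fun i hi => by simpa [hP] using hi
  have hP0 : ∀ i ∉ P, x i = 0 := fun i hi =>
    le_antisymm (by simpa [hP] using hi) (hx i).1
  have hsum : ∀ i ∈ P, x i + ∑ j ∈ G.neighborFinset i ∩ P, x j = e := fun i hi => by
    rw [← closedEffort_eq_add_sum_inter hP0]
    exact (hx i).2.2.resolve_left (hpos i hi).ne'
  have hdeg : ∀ i ∈ P, (G.neighborFinset i ∩ P).card ≤ 1 := fun i hi =>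
    card_neighborFinset_inter_le_one_of_closed_sum hG hpos hsum hi
  -- The inactive vertices with no neighbour isolated in `P`. The isolated vertices of `P` lie in
  -- every maximal independent subset of `P`, so only `D` needs care.
  set D : Finset V := {v | v ∉ P ∧ ∀ q ∈ G.neighborFinset v ∩ P,
    (G.neighborFinset q ∩ P).Nonempty} with hD
  obtain ⟨I, hIP, hI, hID⟩ := exists_indep_dominating_of_matching hG (P := P) (D := D)
    (Finset.disjoint_left.2 fun v hv hvD => by simp [hD, hv] at hvD) hdeg
    (fun v hv => by
      obtain ⟨hvP, hvm⟩ := (Finset.mem_filter.1 hv).2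
      -- A sole active neighbour `q` would need `x q ≥ e`, but `q` shares `e` with its partner `r`
      -- of positive effort.
      by_contra! hlt
      have hv1 := (hx v).2.1
      rw [closedEffort_eq_add_sum_inter hP0, hP0 v hvP, zero_add] at hv1
      rcases (G.neighborFinset v ∩ P).eq_empty_or_nonempty with h0 | ⟨q, hq⟩
      · rw [h0, Finset.sum_empty] at hv1
        linarith
      · have hset : G.neighborFinset v ∩ P = {q} := Finset.eq_singleton_iff_unique_mem.2
          ⟨hq, fun a ha => Finset.card_le_one.1 (by omega) _ ha _ hq⟩
        rw [hset, Finset.sum_singleton] at hv1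
        obtain ⟨r, hr⟩ := hvm q hq
        have h1 := hsum q (Finset.mem_inter.1 hq).2
        have h2 := Finset.single_le_sum (f := x) (fun k _ => (hx k).1) hr
        have h3 := hpos r (Finset.mem_inter.1 hr).2
        linarith)
    (fun v hv => (Finset.mem_filter.1 hv).2.2)
  obtain ⟨S, hIS, ⟨hSP, hS⟩, hSmax⟩ := Finite.exists_le_maximal
    (p := fun T : Finset V => T ⊆ P ∧ G.IsIndepSet (T : Set V)) (a := I) ⟨hIP, hI⟩
  have hdomP : ∀ v ∈ P, v ∉ S → ∃ s ∈ S, G.Adj v s := by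
    intro v hv hvS
    by_contra! hno
    refine hvS (hSmax (y := insert v S) ⟨Finset.insert_subset hv hSP, ?_⟩
      (Finset.subset_insert _ _) (Finset.mem_insert_self _ _))
    rw [Finset.coe_insert]
    exact Set.Pairwise.insert hS fun s hs _ => ⟨hno s hs, fun h' => hno s hs h'.symm⟩
  refine ⟨S, isMaximalIndepSet_iff.2 ⟨hS, fun v hvS => ?_⟩, ?_⟩
  · by_cases hvP : v ∈ P
    · exact hdomP v hvP hvS
    by_cases hvD : v ∈ D
    · obtain ⟨q, hq, hadj⟩ := hID v hvD
      exact ⟨q, hIS hq, hadj⟩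
    · obtain ⟨q, hq, hq0⟩ : ∃ q ∈ G.neighborFinset v ∩ P, ¬(G.neighborFinset q ∩ P).Nonempty := by
        by_contra! h
        exact hvD (Finset.mem_filter.2 ⟨Finset.mem_univ _, hvP, h⟩)
      obtain ⟨hq1, hq2⟩ := Finset.mem_inter.1 hq
      refine ⟨q, ?_, (SimpleGraph.mem_neighborFinset ..).1 hq1⟩
      by_contra hqS
      obtain ⟨s, hs, hadj⟩ := hdomP q hq2 hqS
      exact hq0 ⟨s, by simp [hadj, hSP hs]⟩
  -- Closed neighbourhoods in `P` of distinct vertices of `S` are disjoint because degrees in `P`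
  -- are at most one. Each carries effort exactly `e`.
  · have hdisj : Set.PairwiseDisjoint (S : Set V)
        fun s => insert s (G.neighborFinset s ∩ P) := by
      intro s hs t ht hst
      refine Finset.disjoint_left.2 fun a ha hb => ?_
      have hnadj : ¬ G.Adj s t := hS hs ht hst
      simp only [Finset.mem_insert, Finset.mem_inter, SimpleGraph.mem_neighborFinset] at ha hb
      rcases ha with rfl | ⟨has, haP⟩
      · rcases hb with rfl | ⟨h, -⟩
        · exact hst rfl
        · exact hnadj h.symm
      · rcases hb with rfl | ⟨hat, -⟩
        · exact hnadj has
        · exact hst (Finset.card_le_one.1 (hdeg a haP) s (by simp [has.symm, hSP hs])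
            t (by simp [hat.symm, hSP ht]))
    calc e * S.card = ∑ s ∈ S, ∑ i ∈ insert s (G.neighborFinset s ∩ P), x i := by
          rw [mul_comm, ← nsmul_eq_mul, ← Finset.sum_const]
          refine Finset.sum_congr rfl fun s hs => ?_
          rw [Finset.sum_insert (by simp), hsum s (hSP hs)]
      _ = ∑ i ∈ S.biUnion fun s => insert s (G.neighborFinset s ∩ P), x i :=
          (Finset.sum_biUnion hdisj).symm
      _ ≤ ∑ i, x i := Finset.sum_le_sum_of_subset_of_nonneg (Finset.subset_univ _)
          fun i _ _ => (hx i).1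

/-- The total effort of a profile with sum `e` over all closed neighbourhoods is at most that of any
specialized profile. -/
theorem sum_le_mul_card_of_closedEffort_eq (hx0 : ∀ i, 0 ≤ x i)
    (hx : ∀ i, closedEffort G x i = e) {S : Finset V} (hS : IsMaximalIndepSet G S) :
    ∑ i, x i ≤ e * S.card := by
  obtain ⟨-, hdom⟩ := isMaximalIndepSet_iff.1 hS
  -- As `S` dominates the graph, its closed neighbourhoods count every vertex at least once.
  calc ∑ i, x i ≤ ∑ i, ∑ s ∈ S, if i ∈ insert s (G.neighborFinset s) then x i else 0 := by
        refine Finset.sum_le_sum fun i _ => ?_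
        have hnn : ∀ s ∈ S, 0 ≤ if i ∈ insert s (G.neighborFinset s) then x i else 0 :=
          fun s _ => by split_ifs <;> simp [hx0 i]
        obtain ⟨s, hs, hmem⟩ : ∃ s ∈ S, i ∈ insert s (G.neighborFinset s) := by
          by_cases hi : i ∈ S
          · exact ⟨i, hi, Finset.mem_insert_self _ _⟩
          · obtain ⟨s, hs, hadj⟩ := hdom i hi
            exact ⟨s, hs, by simp [hadj.symm]⟩
        have h := Finset.single_le_sum hnn hs
        rwa [if_pos hmem] at h
    _ = ∑ s ∈ S, closedEffort G x s := by
        rw [Finset.sum_comm]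
        refine Finset.sum_congr rfl fun s _ => ?_
        rw [closedEffort_eq_sum_insert, ← Finset.sum_filter]
        congr 1
        ext i
        simp
    _ = e * S.card := by simp [hx, mul_comm]

end Rounding

/-! ### Extremal independent sets -/

section Optimum

theorem weightedIndepNum_eq {V : Type*} {G : SimpleGraph V} {w : V → ℝ} {S : Finset V}
    (hS : IsMaxWeightIndepSet G w S) : weightedIndepNum G w = ∑ i ∈ S, w i :=
  IsGreatest.csSup_eq ⟨⟨S, hS.1, rfl⟩, by rintro _ ⟨T, hT, rfl⟩; exact hS.2 T hT⟩

theorem indepDomNum_eq {V : Type*} {G : SimpleGraph V} {S : Finset V}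
    (hS : IsSmallestMaximalIndepSet G S) : indepDomNum G = S.card :=
  IsLeast.csInf_eq ⟨⟨S, hS.1, rfl⟩, by rintro _ ⟨T, hT, rfl⟩; exact hS.2 T hT⟩

theorem IsMaxWeightIndepSet.isMaximalIndepSet {V : Type*} [DecidableEq V] {G : SimpleGraph V}
    {w : V → ℝ} {S : Finset V} (hw : ∀ i, 0 < w i) (hS : IsMaxWeightIndepSet G w S) :
    IsMaximalIndepSet G S := by
  refine ⟨hS.1, fun T hT hST v hv => ?_⟩
  by_contra hvS
  have h1 := hS.2 T hT
  have h2 := Finset.sum_lt_sum_of_subset hST hv hvS (hw v) fun j _ _ => (hw j).le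
  linarith

theorem exists_isSmallestMaximalIndepSet {V : Type*} [Fintype V] (G : SimpleGraph V) :
    ∃ S, IsSmallestMaximalIndepSet G S := by
  obtain ⟨S, hS, hmin⟩ := Set.exists_min_image {S | IsMaximalIndepSet G S} Finset.card
    (Set.toFinite _) (exists_isMaximalIndepSet G)
  exact ⟨S, hS, hmin⟩

end Optimum

/-! ### Linear bounds for the welfare -/

section Welfare

variable {V : Type*} [Fintype V] {G : SimpleGraph V} [DecidableRel G.Adj]
variable {c e B : ℝ} {b : ℝ → ℝ} {x : V → ℝ}

theorem sum_closedEffort (x : V → ℝ) :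
    ∑ i, closedEffort G x i = ∑ i, x i + ∑ i, (G.degree i : ℝ) * x i := by
  simp only [closedEffort, Finset.sum_add_distrib, add_right_inj, SimpleGraph.neighborFinset_eq_filter,
    Finset.sum_filter]
  rw [Finset.sum_comm]
  refine Finset.sum_congr rfl fun i _ => ?_
  rw [← Finset.sum_filter, Finset.sum_const, nsmul_eq_mul, ← SimpleGraph.card_neighborFinset_eq_degree,
    SimpleGraph.neighborFinset_eq_filter]
  simp only [G.adj_comm]

theorem welfare_eq (x : V → ℝ) :
    welfare G c b x = ∑ i, b (closedEffort G x i) - c * ∑ i, x i := by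
  simp [welfare, utility, Finset.sum_sub_distrib, Finset.mul_sum]

/-- The welfare with `b` replaced by its tangent at `e`. Each effort is counted once by its owner,
cancelling the cost, and once by each neighbour, leaving the degree weights. -/
theorem sum_tangent (x : V → ℝ) :
    ∑ i, (B + c * (closedEffort G x i - e)) - c * ∑ i, x i
      = Fintype.card V * (B - c * e) + c * ∑ i, (G.degree i : ℝ) * x i := by
  rw [Finset.sum_add_distrib, ← Finset.mul_sum, Finset.sum_sub_distrib, sum_closedEffort]
  simp only [Finset.sum_const, Finset.card_univ, nsmul_eq_mul]
  ring

theorem welfare_le_degree_sum (he : 0 < e) (hb : b ∈ benefitFamily c e B)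
    (hx : IsComplementary G e x) :
    welfare G c b x ≤ Fintype.card V * (B - c * e) + c * ∑ i, (G.degree i : ℝ) * x i := by
  rw [welfare_eq, ← sum_tangent]
  exact sub_le_sub_right (Finset.sum_le_sum fun i _ => benefit_le_tangent he hb (hx i).2.1) _

theorem le_welfare (he : 0 < e) (hb : b ∈ benefitFamily c e B) (hx : IsComplementary G e x) :
    Fintype.card V * B - c * ∑ i, x i ≤ welfare G c b x := by
  rw [welfare_eq]
  have h := Finset.sum_le_sum fun i (_ : i ∈ Finset.univ) => le_benefit he hb (hx i).2.1
  rw [Finset.sum_const, Finset.card_univ, nsmul_eq_mul] at h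
  linarith

variable [DecidableEq V]

/-- For each agent the chord of slope `σ c` falls short of the tangent by at most `(1 - σ) c e (n -
1)`, the gap at `n e`. -/
theorem degree_sum_sub_le_welfare (hn : 2 ≤ Fintype.card V) (hc : 0 < c) (he : 0 < e)
    (hb : b ∈ benefitFamily c e B) (hx : IsComplementary G e x) :
    Fintype.card V * (B - c * e) + c * ∑ i, (G.degree i : ℝ) * x i
      - (1 - concavity (Fintype.card V) c e b) * (Fintype.card V * (c * e * (Fintype.card V - 1)))
      ≤ welfare G c b x := by
  rw [welfare_eq, ← sum_tangent]
  have hi : ∀ i, B + c * (closedEffort G x i - e) - (1 - concavity (Fintype.card V) c e b)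
      * (c * e * (Fintype.card V - 1)) ≤ b (closedEffort G x i) := by
    intro i
    have h1 := chord_le_benefit hn hc he hb (hx i).2.1 (hx.closedEffort_le he i)
    have h2 : (1 - concavity (Fintype.card V) c e b) * (c * (closedEffort G x i - e))
        ≤ (1 - concavity (Fintype.card V) c e b) * (c * (e * (Fintype.card V - 1))) := by
      refine mul_le_mul_of_nonneg_left (mul_le_mul_of_nonneg_left ?_ hc.le)
        (sub_nonneg.2 (concavity_le_one hn hc he hb))
      linarith [hx.closedEffort_le he i]
    linarith
  have h := Finset.sum_le_sum fun i (_ : i ∈ Finset.univ) => hi i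
  rw [Finset.sum_sub_distrib, Finset.sum_const, Finset.card_univ, nsmul_eq_mul] at h
  linarith

theorem welfare_le_add_concavity (hn : 2 ≤ Fintype.card V) (hc : 0 < c) (he : 0 < e)
    (hb : b ∈ benefitFamily c e B) (hx : IsComplementary G e x) :
    welfare G c b x ≤ Fintype.card V * B - c * ∑ i, x i
      + concavity (Fintype.card V) c e b * (Fintype.card V * (c * e * (Fintype.card V - 1))) := by
  rw [welfare_eq]
  have h := Finset.sum_le_sum fun i (_ : i ∈ Finset.univ) =>
    benefit_le_add_concavity hn hc he hb (hx i).2.1 (hx.closedEffort_le he i)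
  rw [Finset.sum_const, Finset.card_univ, nsmul_eq_mul] at h
  linarith

end Welfare

/-! ### Passage to the limit -/

section Limits

variable {V : Type*} [Fintype V] [DecidableEq V] {G : SimpleGraph V} [DecidableRel G.Adj]
variable {c e B : ℝ}

/-- Squeezing by an error that vanishes linearly with `σ_b - s`. -/
theorem tendsto_concavityTo {n : ℕ} {s L K : ℝ} {F : (ℝ → ℝ) → ℝ}
    (h : ∀ b ∈ benefitFamily c e B, |F b - L| ≤ |concavity n c e b - s| * K) :
    Tendsto F (concavityTo n c e B s) (𝓝 L) := by
  have hσ : Tendsto (concavity n c e) (concavityTo n c e B s) (𝓝 s) :=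
    tendsto_comap.mono_left inf_le_left
  have hK : Tendsto (fun b => |concavity n c e b - s| * K) (concavityTo n c e B s) (𝓝 0) := by
    simpa using ((hσ.sub_const s).abs).mul_const K
  refine tendsto_iff_norm_sub_tendsto_zero.2 (squeeze_zero' (.of_forall fun _ => norm_nonneg _)
    ?_ hK)
  exact mem_inf_of_right fun b hb => h b hb

theorem two_le_card_of_forall_not_isIsolated {V : Type*} [Fintype V] [Nonempty V]
    {G : SimpleGraph V} (hG : ∀ i, ¬ G.IsIsolated i) : 2 ≤ Fintype.card V := by
  obtain ⟨i⟩ := ‹Nonempty V›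
  obtain ⟨j, hj⟩ := not_forall_not.1 (hG i)
  exact Fintype.one_lt_card_iff.2 ⟨i, j, hj.ne⟩

/-- The free value `r` lets one sandwich serve all three limits of (a). Greedy rounding and the
tangent bound the optimum from above; the chord bounds the profile of `S` from below. -/
theorem abs_sub_le_of_concavity_one {S : Finset V}
    (hn : 2 ≤ Fintype.card V) (hc : 0 < c) (he : 0 < e)
    (hS : IsMaxWeightIndepSet G (fun i => (G.degree i : ℝ)) S) (hSm : IsMaximalIndepSet G S)
    {b : ℝ → ℝ} (hb : b ∈ benefitFamily c e B) {r : ℝ}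
    (h1 : welfare G c b (specialistProfile e S) ≤ r) (h2 : r ≤ maxWelfare G c b) :
    |r - (Fintype.card V * (B - c * e)
        + c * e * weightedIndepNum G (fun i => (G.degree i : ℝ)))|
      ≤ |concavity (Fintype.card V) c e b - 1|
        * (Fintype.card V * (c * e * (Fintype.card V - 1))) := by
  obtain ⟨x, hx, hxr⟩ := (isGreatest_maxWelfare (G := G) he hb).1
  have hx := (mem_NE_iff he hb).1 hx
  obtain ⟨I, hI, hle⟩ := hx.exists_indep_sum_mul_le he
    (w := fun i => (G.degree i : ℝ)) fun i => Nat.cast_nonneg _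
  have h3 := welfare_le_degree_sum he hb hx
  have h4 := degree_sum_sub_le_welfare hn hc he hb (isComplementary_specialistProfile he hSm)
  have h5 : ∑ i, (G.degree i : ℝ) * specialistProfile e S i
      = e * ∑ i ∈ S, (G.degree i : ℝ) := by
    simp [specialistProfile, Finset.mul_sum, mul_comm]
  have h6 := mul_le_mul_of_nonneg_left (hle.trans (mul_le_mul_of_nonneg_left (hS.2 I hI) he.le))
    hc.le
  rw [h5] at h4
  rw [weightedIndepNum_eq hS, abs_of_nonpos (sub_nonpos.2 (concavity_le_one hn hc he hb)),
    abs_of_nonpos] <;> linarith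

/-- Here `x` is an equilibrium whose welfare bounds `r` from above. The rounding enters only through
`hSx`, so the estimate itself needs no forest. -/
theorem abs_sub_le_of_concavity_zero {S : Finset V}
    (hn : 2 ≤ Fintype.card V) (hc : 0 < c) (he : 0 < e)
    (hS : IsSmallestMaximalIndepSet G S)
    {b : ℝ → ℝ} (hb : b ∈ benefitFamily c e B) {x : V → ℝ} (hx : IsComplementary G e x)
    (hSx : e * S.card ≤ ∑ i, x i) {r : ℝ}
    (h1 : welfare G c b (specialistProfile e S) ≤ r) (h2 : r ≤ welfare G c b x) :
    |r - (Fintype.card V * B - c * e * indepDomNum G)|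
      ≤ |concavity (Fintype.card V) c e b - 0|
        * (Fintype.card V * (c * e * (Fintype.card V - 1))) := by
  have h3 := welfare_le_add_concavity hn hc he hb hx
  have h4 := le_welfare he hb (isComplementary_specialistProfile he hS.1)
  have h6 := mul_le_mul_of_nonneg_left hSx hc.le
  have hn' : (0 : ℝ) < (Fintype.card V : ℝ) - 1 := by
    have : (2 : ℝ) ≤ Fintype.card V := by exact_mod_cast hn
    linarith
  have h7 : 0 ≤ (Fintype.card V : ℝ) * (c * e * (Fintype.card V - 1)) := by positivity
  have h8 := mul_le_mul_of_nonneg_right (le_abs_self (concavity (Fintype.card V) c e b)) h7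
  rw [sum_specialistProfile] at h4
  rw [indepDomNum_eq hS, sub_zero, abs_of_nonneg] <;> linarith

/-- This holds in every graph: the best specialized equilibrium already comes from a maximal
independent set, so no rounding is needed. -/
theorem tendsto_maxSpecializedWelfare_zero (hn : 2 ≤ Fintype.card V) (hc : 0 < c) (he : 0 < e) :
    Tendsto (fun b => maxSpecializedWelfare G c e b) (concavityTo (Fintype.card V) c e B 0)
      (𝓝 (Fintype.card V * B - c * e * indepDomNum G)) := by
  obtain ⟨S, hS⟩ := exists_isSmallestMaximalIndepSet G
  refine tendsto_concavityTo (K := Fintype.card V * (c * e * (Fintype.card V - 1))) fun b hb => ?_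
  obtain ⟨x, hx, hxr⟩ := (isGreatest_maxSpecializedWelfare (G := G) he hb).1
  have hxc := (mem_NE_iff he hb).1 hx.1
  obtain ⟨T, hT, rfl⟩ := exists_eq_specialistProfile he hxc hx.2
  refine abs_sub_le_of_concavity_zero hn hc he hS hb hxc ?_
    (le_maxSpecializedWelfare he hb (specialistProfile_mem_SNE he hb hS.1)) hxr.ge
  rw [sum_specialistProfile]
  exact mul_le_mul_of_nonneg_left (by exact_mod_cast hS.2 T hT) he.le

theorem closedEffort_eq_of_mem_DNE (he : 0 < e) {b : ℝ → ℝ} (hb : b ∈ benefitFamily c e B)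
    {x : V → ℝ} (hx : x ∈ DNE G c b) (i : V) : closedEffort G x i = e :=
  ((mem_NE_iff he hb).1 hx.1 i).2.2.resolve_left (hx.2 i).ne'

theorem welfare_of_mem_DNE (he : 0 < e) {b : ℝ → ℝ} (hb : b ∈ benefitFamily c e B)
    {x : V → ℝ} (hx : x ∈ DNE G c b) :
    welfare G c b x = Fintype.card V * B - c * ∑ i, x i := by
  simp [welfare_eq, closedEffort_eq_of_mem_DNE he hb hx, hb.2.1]

end Limits

end PublicGoods

/-! ### The main theorem -/

theorem theorem1 {V : Type*} [Fintype V] [DecidableEq V] [Nonempty V]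
    (G : SimpleGraph V) [DecidableRel G.Adj] (hG : ∀ i, ¬ G.IsIsolated i)
    (c e B : ℝ) (hc : 0 < c) (he : 0 < e) :
    -- the limits `σ_b → 1` and `σ_b → 0` are meaningful, and the maxima are attained
    ((PublicGoods.concavityTo (Fintype.card V) c e B 1).NeBot ∧
      (PublicGoods.concavityTo (Fintype.card V) c e B 0).NeBot ∧
      ∀ b ∈ PublicGoods.benefitFamily c e B,
        IsGreatest (PublicGoods.welfare G c b '' PublicGoods.NE G c b)
          (PublicGoods.maxWelfare G c b) ∧
        IsGreatest (PublicGoods.welfare G c b '' PublicGoods.SNE G c e b)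
          (PublicGoods.maxSpecializedWelfare G c e b)) ∧
    -- (a)
    (∀ S : Finset V, PublicGoods.IsMaxWeightIndepSet G (fun i => (G.degree i : ℝ)) S →
      (∀ b ∈ PublicGoods.benefitFamily c e B,
        PublicGoods.specialistProfile e S ∈ PublicGoods.SNE G c e b) ∧
      Tendsto (fun b => PublicGoods.maxWelfare G c b)
        (PublicGoods.concavityTo (Fintype.card V) c e B 1)
        (𝓝 (Fintype.card V * (B - c * e) +
          c * e * PublicGoods.weightedIndepNum G (fun i => (G.degree i : ℝ)))) ∧
      Tendsto (fun b => PublicGoods.welfare G c b (PublicGoods.specialistProfile e S))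
        (PublicGoods.concavityTo (Fintype.card V) c e B 1)
        (𝓝 (Fintype.card V * (B - c * e) +
          c * e * PublicGoods.weightedIndepNum G (fun i => (G.degree i : ℝ)))) ∧
      Tendsto (fun b => PublicGoods.maxSpecializedWelfare G c e b)
        (PublicGoods.concavityTo (Fintype.card V) c e B 1)
        (𝓝 (Fintype.card V * (B - c * e) +
          c * e * PublicGoods.weightedIndepNum G (fun i => (G.degree i : ℝ))))) ∧
    -- (b)
    (G.IsAcyclic → ∀ S : Finset V, PublicGoods.IsSmallestMaximalIndepSet G S →
      (∀ b ∈ PublicGoods.benefitFamily c e B,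
        PublicGoods.specialistProfile e S ∈ PublicGoods.SNE G c e b) ∧
      Tendsto (fun b => PublicGoods.maxWelfare G c b)
        (PublicGoods.concavityTo (Fintype.card V) c e B 0)
        (𝓝 (Fintype.card V * B - c * e * PublicGoods.indepDomNum G)) ∧
      Tendsto (fun b => PublicGoods.welfare G c b (PublicGoods.specialistProfile e S))
        (PublicGoods.concavityTo (Fintype.card V) c e B 0)
        (𝓝 (Fintype.card V * B - c * e * PublicGoods.indepDomNum G)) ∧
      Tendsto (fun b => PublicGoods.maxSpecializedWelfare G c e b)
        (PublicGoods.concavityTo (Fintype.card V) c e B 0)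
        (𝓝 (Fintype.card V * B - c * e * PublicGoods.indepDomNum G))) ∧
    -- (c)
    ((∀ b₁ ∈ PublicGoods.benefitFamily c e B, ∀ b₂ ∈ PublicGoods.benefitFamily c e B,
        ∀ x ∈ PublicGoods.DNE G c b₁,
          x ∈ PublicGoods.DNE G c b₂ ∧ PublicGoods.welfare G c b₁ x = PublicGoods.welfare G c b₂ x) ∧
      ∃ L : ℝ,
        Tendsto (fun b => PublicGoods.maxSpecializedWelfare G c e b)
          (PublicGoods.concavityTo (Fintype.card V) c e B 0) (𝓝 L) ∧
        ∀ b ∈ PublicGoods.benefitFamily c e B,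
          (L : EReal) ≤ PublicGoods.infDistributedWelfare G c b) := by

  have hn := PublicGoods.two_le_card_of_forall_not_isIsolated hG
  refine ⟨⟨PublicGoods.concavityTo_one_neBot hn B hc he,
    PublicGoods.concavityTo_zero_neBot hn B hc he, fun b hb =>
      ⟨PublicGoods.isGreatest_maxWelfare he hb, PublicGoods.isGreatest_maxSpecializedWelfare he hb⟩⟩,
    fun S hS => ?_, fun hac S hS => ?_, fun b₁ hb₁ b₂ hb₂ x hx => ?_, ?_⟩
  -- Without isolated vertices all degree weights are positive, so a set of maximum weight is
  -- maximal for inclusion.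
  · have hSm := hS.isMaximalIndepSet fun i => Nat.cast_pos.2 <| by
      obtain ⟨j, hj⟩ := not_forall_not.1 (hG i)
      exact (G.degree_pos_iff_exists_adj i).2 ⟨j, hj⟩
    have hmem : ∀ b ∈ PublicGoods.benefitFamily c e B,
        PublicGoods.specialistProfile e S ∈ PublicGoods.SNE G c e b := fun b hb =>
      PublicGoods.specialistProfile_mem_SNE he hb hSm
    have hle := fun b hb => PublicGoods.le_maxSpecializedWelfare he hb (hmem b hb)
    have hle' := fun b (hb : b ∈ PublicGoods.benefitFamily c e B) =>
      PublicGoods.maxSpecializedWelfare_le_maxWelfare (G := G) he hb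
    exact ⟨hmem,
      PublicGoods.tendsto_concavityTo fun b hb => PublicGoods.abs_sub_le_of_concavity_one hn hc he
        hS hSm hb ((hle b hb).trans (hle' b hb)) le_rfl,
      PublicGoods.tendsto_concavityTo fun b hb => PublicGoods.abs_sub_le_of_concavity_one hn hc he
        hS hSm hb le_rfl ((hle b hb).trans (hle' b hb)),
      PublicGoods.tendsto_concavityTo fun b hb => PublicGoods.abs_sub_le_of_concavity_one hn hc he
        hS hSm hb (hle b hb) (hle' b hb)⟩
  · have hmem : ∀ b ∈ PublicGoods.benefitFamily c e B,
        PublicGoods.specialistProfile e S ∈ PublicGoods.SNE G c e b := fun b hb =>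
      PublicGoods.specialistProfile_mem_SNE he hb hS.1
    refine ⟨hmem, PublicGoods.tendsto_concavityTo
        (K := Fintype.card V * (c * e * (Fintype.card V - 1))) fun b hb => ?_,
      PublicGoods.tendsto_concavityTo fun b hb => PublicGoods.abs_sub_le_of_concavity_zero hn hc he
        hS hb (PublicGoods.isComplementary_specialistProfile he hS.1)
        (PublicGoods.sum_specialistProfile S).ge le_rfl le_rfl,
      PublicGoods.tendsto_maxSpecializedWelfare_zero hn hc he⟩
    obtain ⟨x, hx, hxr⟩ := (PublicGoods.isGreatest_maxWelfare (G := G) he hb).1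
    have hxc := (PublicGoods.mem_NE_iff he hb).1 hx
    obtain ⟨T, hT, hTx⟩ := hxc.exists_isMaximalIndepSet_card_le hac he
    exact PublicGoods.abs_sub_le_of_concavity_zero hn hc he hS hb hxc
      ((mul_le_mul_of_nonneg_left (by exact_mod_cast hS.2 T hT) he.le).trans hTx)
      ((PublicGoods.isGreatest_maxWelfare he hb).2 ⟨_, (hmem b hb).1, rfl⟩) hxr.ge
  · have hx₂ : x ∈ PublicGoods.DNE G c b₂ :=
      ⟨(PublicGoods.mem_NE_iff he hb₂).2 ((PublicGoods.mem_NE_iff he hb₁).1 hx.1), hx.2⟩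
    exact ⟨hx₂, (PublicGoods.welfare_of_mem_DNE he hb₁ hx).trans
      (PublicGoods.welfare_of_mem_DNE he hb₂ hx₂).symm⟩
  · refine ⟨_, PublicGoods.tendsto_maxSpecializedWelfare_zero hn hc he, fun b hb =>
      le_iInf₂ fun x hx => EReal.coe_le_coe_iff.2 ?_⟩
    obtain ⟨S, hS⟩ := PublicGoods.exists_isSmallestMaximalIndepSet G
    have h := mul_le_mul_of_nonneg_left (PublicGoods.sum_le_mul_card_of_closedEffort_eq
      (fun i => (hx.2 i).le) (PublicGoods.closedEffort_eq_of_mem_DNE he hb hx) hS.1) hc.le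
    rw [PublicGoods.welfare_of_mem_DNE he hb hx, PublicGoods.indepDomNum_eq hS]
    linarith
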